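/- Let $\mathbf H$ be the skew field of real quaternions and, for $A=(a_{ij})\in M(n,\mathbf H)$, let $A^*$ denote the conjugate transpose of $A$. Row and column determinants. For a permutation $\sigma$ of $\{1,\dots,n\}$ and an index $k$ lying in a cycle of $\sigma$ of length $l$ (fixed points are cycles of length $1$), put $$w_k(\sigma)=a_{k\,\sigma(k)}\,a_{\sigma(k)\,\sigma^2(k)}\cdots a_{\sigma^{l-1}(k)\,k}.$$ For an index $i$ let $k_2<k_3<\dots<k_r$ be the least elements of the cycles of $\sigma$ that do not contain $i$, so that $r$ is the number of cycles of $\sigma$. The $i$-th row determinant and the $i$-th column determinant of $A$ are $$\mathrm{rdet}_i A=\sum_{\sigma\in S_n}(-1)^{n-r}\,w_i(\sigma)\,w_{k_2}(\sigma)\cdots w_{k_r}(\sigma),\qquad \mathrm{cdet}_i A=\sum_{\sigma\in S_n}(-1)^{n-r}\,w_{k_r}(\sigma)\cdots w_{k_2}(\sigma)\,w_i(\sigma).$$ Theorem 9.1. Let $A\in M(n,\mathbf H)$ and let $y\in\mathbf H^{n\times 1}$ be a column vector. All the row determinants $\mathrm{rdet}_i(A^*A)$ and all the column determinants $\mathrm{cdet}_i(A^*A)$,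 $i=1,\dots,n$, are equal to one and the same real number, denoted $\mathrm{ddet}\,A=\det(A^*A)$ (the double determinant of $A$; it is $1$ if $n=0$). If $\mathrm{ddet}\,A\neq 0$, then the right system of linear equations $A\cdot x=y$, that is $\sum_{j}a_{ij}x_j=y_i$ for $i=1,\dots,n$, has exactly one solution $x\in\mathbf H^{n\times 1}$, and its components are $$x_j=\frac{\mathrm{cdet}_j\big((A^*A)_{.j}(f)\big)}{\mathrm{ddet}\,A},\qquad j=1,\dots,n,$$ where $f=A^*y$ and $(A^*A)_{.j}(f)$ is the matrix obtained from $A^*A$ by replacing its $j$-th column with $f$. -/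

import Mathlib

open scoped Matrix Quaternion

namespace QuaternionCramer

/-- The product of matrix entries along the cycle of `σ` through `k`, written starting at `k`:
`a_{k, σ k} * a_{σ k, σ² k} * ⋯ * a_{σ^{l-1} k, k}`, with `l` the length of this cycle
(`l = 1` if `k` is a fixed point). -/
noncomputable def cycleWord {R : Type*} [Ring R] {n : ℕ} (A : Matrix (Fin n) (Fin n) R)
    (σ : Equiv.Perm (Fin n)) (k : Fin n) : R :=
  ((List.range (Function.minimalPeriod σ k)).map
    fun m => A ((σ ^ m) k) ((σ ^ (m + 1)) k)).prod

/-- The least elements of the cycles of `σ` not containing `i` (fixed points count as cycles),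
listed in increasing order. -/
def cycleLeaders {n : ℕ} (σ : Equiv.Perm (Fin n)) (i : Fin n) : List (Fin n) :=
  (List.finRange n).filter fun k => ¬ σ.SameCycle i k ∧ ∀ m, σ.SameCycle k m → k ≤ m

/-- The `i`-th row determinant: in each monomial the cycle through `i` is written first (starting
at `i`), and the other cycles follow from left to right in increasing order of their least
elements, each one starting at its least element. -/
noncomputable def rdet {R : Type*} [Ring R] {n : ℕ} (i : Fin n)
    (A : Matrix (Fin n) (Fin n) R) : R :=
  ∑ σ : Equiv.Perm (Fin n), Equiv.Perm.sign σ •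
    (cycleWord A σ i * ((cycleLeaders σ i).map (cycleWord A σ)).prod)

/-- The `j`-th column determinant: in each monomial the cycle through `j` is written last, and the
other cycles precede it, from right to left in increasing order of their least elements. In the
right-ordered notation a cycle `(j_l … j_1 j)` contributes `a_{j j_l} ⋯ a_{j_2 j_1} a_{j_1 j}`,
which is `cycleWord` at `j`. -/
noncomputable def cdet {R : Type*} [Ring R] {n : ℕ} (j : Fin n)
    (A : Matrix (Fin n) (Fin n) R) : R :=
  ∑ τ : Equiv.Perm (Fin n), Equiv.Perm.sign τ •
    (((cycleLeaders τ j).reverse.map (cycleWord A τ)).prod * cycleWord A τ j)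

/-- The determinant of a Hermitian matrix, as its first row determinant (for a Hermitian quaternion
matrix all row and column determinants coincide); the empty matrix has determinant `1`. -/
noncomputable def hermDet {R : Type*} [Ring R] : {n : ℕ} → Matrix (Fin n) (Fin n) R → R
  | 0, _ => 1
  | _ + 1, A => rdet 0 A

/-- The double determinant `ddet A = det (A* A)`. -/
noncomputable def ddet {n : ℕ} (A : Matrix (Fin n) (Fin n) ℍ[ℝ]) : ℍ[ℝ] :=
  hermDet (Aᴴ * A)

end QuaternionCramer

/-!
Write `H = Aᴴ * A`, a Hermitian matrix. The monomials of row and column determinants are products of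
words, one for each cycle of a permutation, and two observations reduce everything to commutative
bookkeeping.

* *Averaging.* Reversing one cycle of `σ` (`flipCycle`) keeps the sign and the partition into
  cycles, and conjugates the word of this cycle if the matrix entries it meets are Hermitian. Since
  `w + star w = 2 Re w`, every such word may be replaced by its real part, which is central and does
  not depend on the starting point of the cycle (`cdet_eq_sum_re`). For `H` this applies to all
  cycles, so `cdet i H` is the real number `realDet H`, in which `i` does not occur
  (`cdet_eq_realDet`); and `star (rdet i H) = cdet i H` by reindexing with `σ⁻¹` (`star_rdet`).
* *Merging.* Let `B` be `H` with column `j` replaced by column `k ≠ j`. If `j` and `k` lie in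
  different cycles of `σ`, these are merged in `swap j k * σ`, and as the columns `j` and `k` of `B`
  agree, the word of `j` for the merged permutation is the product of the words of `j` and of `k` for
  `σ` (`cycleWord_swap_mul`). Averaging over the orientation of the cycle of `k`, the contributions
  of `σ` and `swap j k * σ` cancel, so `cdet j B = 0` (`cdet_eq_zero_of_col_eq`).

Column `j` enters each monomial of `cdet j` only through the last factor, so `cdet j` is right linear
in it. Hence `cdet j` of `H` with column `j` replaced by `H *ᵥ x` is `realDet H * x j`
(`cdet_updateCol_mulVec_self`). If `realDet H ≠ 0`, this determines `x` from `A *ᵥ x`; in particular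
`A` is injective on columns, hence surjective, and the solution that exists is the one given by the
formula.
-/

namespace QuaternionCramer

open Equiv Equiv.Perm

/-! ### Cycles of permutations: reversal and merging -/

section Permutations

variable {α : Type*}

theorem pow_apply_congr {σ τ : Perm α} {x : α} (h : ∀ z, σ.SameCycle x z → τ z = σ z) (t : ℕ) :
    (τ ^ t) x = (σ ^ t) x := by
  induction t with
  | zero => rfl
  | succ t ih =>
    rw [pow_succ', pow_succ', Perm.mul_apply, Perm.mul_apply, ih]
    exact h _ ⟨t, by simp⟩

theorem sameCycle_iff_exists_nat [Finite α] {σ : Perm α} {x y : α} :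
    σ.SameCycle x y ↔ ∃ t : ℕ, (σ ^ t) x = y :=
  ⟨fun h => let ⟨t, _, ht⟩ := h.exists_pow_eq'; ⟨t, ht⟩, fun ⟨t, ht⟩ => ⟨t, by simpa using ht⟩⟩

theorem sameCycle_congr [Finite α] {σ τ : Perm α} {x : α} (h : ∀ t : ℕ, (τ ^ t) x = (σ ^ t) x)
    (y : α) : τ.SameCycle x y ↔ σ.SameCycle x y := by
  simp only [sameCycle_iff_exists_nat, h]

theorem minimalPeriod_congr {σ τ : Perm α} {x : α} (h : ∀ t : ℕ, (τ ^ t) x = (σ ^ t) x) :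
    Function.minimalPeriod τ x = Function.minimalPeriod σ x := by
  apply Function.minimalPeriod_eq_minimalPeriod_iff.mpr
  intro t
  simp only [Function.IsPeriodicPt, Function.IsFixedPt, Perm.iterate_eq_pow, h]

theorem pow_minimalPeriod_apply (σ : Perm α) (x : α) :
    (σ ^ Function.minimalPeriod σ x) x = x := by
  rw [← Perm.iterate_eq_pow]; exact Function.iterate_minimalPeriod

theorem minimalPeriod_pos [Finite α] (σ : Perm α) (x : α) : 0 < Function.minimalPeriod σ x :=
  Function.minimalPeriod_pos_of_mem_periodicPts
    (Function.Injective.mem_periodicPts σ.injective x)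

theorem pow_apply_ne_of_lt_minimalPeriod {σ : Perm α} {x : α} {t : ℕ} (h0 : t ≠ 0)
    (h : t < Function.minimalPeriod σ x) : (σ ^ t) x ≠ x := by
  rw [← Perm.iterate_eq_pow]
  exact Function.not_isPeriodicPt_of_pos_of_lt_minimalPeriod h0 h

theorem exists_lt_minimalPeriod [Finite α] {σ : Perm α} {x y : α} (h : σ.SameCycle x y) :
    ∃ t < Function.minimalPeriod σ x, (σ ^ t) x = y := by
  obtain ⟨t, rfl⟩ := sameCycle_iff_exists_nat.mp h
  refine ⟨t % Function.minimalPeriod σ x, Nat.mod_lt _ (minimalPeriod_pos σ x), ?_⟩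
  rw [← Perm.iterate_eq_pow, ← Perm.iterate_eq_pow, Function.iterate_mod_minimalPeriod_eq]

/-- If `j` and `k` lie in different cycles of `σ`, the orbit of `j` under `swap j k * σ` first runs
through the `σ`-cycle of `j`, from `j` on, and then through that of `k`, from `k` on. This lemma and
the ones on `swap_mul_pow` below make this precise. -/
theorem swap_mul_pow_apply [DecidableEq α] {σ : Perm α} {j k : α} (h : ¬ σ.SameCycle j k) {t : ℕ}
    (ht : t < Function.minimalPeriod σ j) : ((swap j k * σ) ^ t) j = (σ ^ t) j := by
  induction t with
  | zero => rfl
  | succ t ih =>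
    have e := ih (by omega)
    have hs : σ ((σ ^ t) j) = (σ ^ (t + 1)) j := by rw [pow_succ', Perm.mul_apply]
    rw [pow_succ', Perm.mul_apply, e, Perm.mul_apply, hs]
    exact swap_apply_of_ne_of_ne (pow_apply_ne_of_lt_minimalPeriod (by omega) ht)
      fun hk => h ⟨(t + 1 : ℕ), by rwa [zpow_natCast]⟩

theorem swap_mul_pow_of_not_sameCycle [DecidableEq α] {σ : Perm α} {j k x : α} (hj : ¬ σ.SameCycle j x)
    (hk : ¬ σ.SameCycle k x) (t : ℕ) : ((swap j k * σ) ^ t) x = (σ ^ t) x := by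
  refine pow_apply_congr (fun z hz => ?_) t
  have hz' := sameCycle_apply_right.mpr hz
  rw [Perm.mul_apply]
  apply swap_apply_of_ne_of_ne
  · rintro rfl; exact hj hz'.symm
  · rintro rfl; exact hk hz'.symm

/-- The permutation obtained from `σ` by reversing the cycle through `m`. -/
def flipCycle [Fintype α] [DecidableEq α] (m : α) (σ : Perm α) : Perm α :=
  σ * (σ.cycleOf m)⁻¹ * (σ.cycleOf m)⁻¹

variable [Fintype α] [DecidableEq α]

theorem flipCycle_apply_of_sameCycle {σ : Perm α} {m x : α} (h : σ.SameCycle m x) :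
    flipCycle m σ x = σ⁻¹ x := by
  have h1 : σ.SameCycle m (σ⁻¹ x) := sameCycle_symm_apply_right.mpr h
  have e : ∀ z, σ.SameCycle m z → (σ.cycleOf m)⁻¹ z = σ⁻¹ z := fun z hz => by
    rw [cycleOf_inv, cycleOf_apply, if_pos (sameCycle_inv.mpr hz)]
  simp only [flipCycle, Perm.mul_apply]
  rw [e x h, e _ h1, Perm.inv_def, Equiv.apply_symm_apply]

theorem flipCycle_apply_of_not_sameCycle {σ : Perm α} {m x : α} (h : ¬ σ.SameCycle m x) :
    flipCycle m σ x = σ x := by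
  have e : (σ.cycleOf m)⁻¹ x = x := by
    rw [cycleOf_inv, cycleOf_apply, if_neg (fun h' => h (sameCycle_inv.mp h'))]
  simp only [flipCycle, Perm.mul_apply]
  rw [e, e]

theorem flipCycle_pow_of_sameCycle {σ : Perm α} {m x : α} (h : σ.SameCycle m x) (t : ℕ) :
    (flipCycle m σ ^ t) x = (σ⁻¹ ^ t) x :=
  pow_apply_congr (fun _ hz => flipCycle_apply_of_sameCycle (h.trans (sameCycle_inv.mp hz))) t

theorem flipCycle_pow_of_not_sameCycle {σ : Perm α} {m x : α} (h : ¬ σ.SameCycle m x) (t : ℕ) :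
    (flipCycle m σ ^ t) x = (σ ^ t) x :=
  pow_apply_congr (fun _ hz => flipCycle_apply_of_not_sameCycle
    fun h' => h (h'.trans hz.symm)) t

theorem sameCycle_flipCycle {σ : Perm α} {m x y : α} :
    (flipCycle m σ).SameCycle x y ↔ σ.SameCycle x y := by
  by_cases h : σ.SameCycle m x
  · rw [sameCycle_congr (flipCycle_pow_of_sameCycle h), sameCycle_inv]
  · exact sameCycle_congr (flipCycle_pow_of_not_sameCycle h) y

theorem flipCycle_flipCycle (m : α) (σ : Perm α) : flipCycle m (flipCycle m σ) = σ := by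
  ext x
  by_cases h : σ.SameCycle m x
  · rw [flipCycle_apply_of_sameCycle (sameCycle_flipCycle.mpr h), Perm.inv_eq_iff_eq,
      flipCycle_apply_of_sameCycle (sameCycle_apply_right.mpr h), Perm.inv_def, Equiv.symm_apply_apply]
  · rw [flipCycle_apply_of_not_sameCycle (fun h' => h (sameCycle_flipCycle.mp h')),
      flipCycle_apply_of_not_sameCycle h]

theorem sign_flipCycle (m : α) (σ : Perm α) : sign (flipCycle m σ) = sign σ := by
  simp [flipCycle, mul_assoc]

theorem swap_mul_pow_minimalPeriod {σ : Perm α} {j k : α} (h : ¬ σ.SameCycle j k) :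
    ((swap j k * σ) ^ Function.minimalPeriod σ j) j = k := by
  obtain ⟨l, hl⟩ := Nat.exists_eq_succ_of_ne_zero (minimalPeriod_pos σ j).ne'
  have hp := pow_minimalPeriod_apply σ j
  rw [hl] at hp ⊢
  rw [Nat.succ_eq_add_one, pow_succ', Perm.mul_apply] at hp ⊢
  rw [swap_mul_pow_apply h (by omega), Perm.mul_apply, hp, swap_apply_left]

theorem swap_mul_pow_minimalPeriod_add {σ : Perm α} {j k : α} (h : ¬ σ.SameCycle j k) {t : ℕ}
    (ht : t < Function.minimalPeriod σ k) :
    ((swap j k * σ) ^ (Function.minimalPeriod σ j + t)) j = (σ ^ t) k := by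
  rw [add_comm, pow_add, Perm.mul_apply, swap_mul_pow_minimalPeriod h, swap_comm,
    swap_mul_pow_apply (fun h' => h h'.symm) ht]

theorem swap_mul_pow_minimalPeriod_add_minimalPeriod {σ : Perm α} {j k : α}
    (h : ¬ σ.SameCycle j k) :
    ((swap j k * σ) ^ (Function.minimalPeriod σ j + Function.minimalPeriod σ k)) j = j := by
  rw [add_comm, pow_add, Perm.mul_apply, swap_mul_pow_minimalPeriod h, swap_comm,
    swap_mul_pow_minimalPeriod (fun h' => h h'.symm)]

theorem minimalPeriod_swap_mul {σ : Perm α} {j k : α} (h : ¬ σ.SameCycle j k) :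
    Function.minimalPeriod (swap j k * σ : Perm α) j =
      Function.minimalPeriod σ j + Function.minimalPeriod σ k := by
  have hj := minimalPeriod_pos σ j
  apply le_antisymm
  · apply Function.IsPeriodicPt.minimalPeriod_le (by omega)
    rw [Function.IsPeriodicPt, Function.IsFixedPt, Perm.iterate_eq_pow]
    exact swap_mul_pow_minimalPeriod_add_minimalPeriod h
  · by_contra! hlt
    have hpos := minimalPeriod_pos (swap j k * σ) j
    have hp := pow_minimalPeriod_apply (swap j k * σ) j
    generalize Function.minimalPeriod (swap j k * σ : Perm α) j = t at hlt hpos hp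
    rcases lt_or_ge t (Function.minimalPeriod σ j) with h1 | h1
    · rw [swap_mul_pow_apply h h1] at hp
      exact pow_apply_ne_of_lt_minimalPeriod hpos.ne' h1 hp
    · obtain ⟨s, rfl⟩ := Nat.exists_eq_add_of_le h1
      rw [swap_mul_pow_minimalPeriod_add h (by omega)] at hp
      exact h (SameCycle.symm ⟨s, by rwa [zpow_natCast]⟩)

theorem sameCycle_swap_mul {σ : Perm α} {j k : α} (h : ¬ σ.SameCycle j k) :
    (swap j k * σ).SameCycle j k :=
  ⟨(Function.minimalPeriod σ j : ℕ), by rw [zpow_natCast, swap_mul_pow_minimalPeriod h]⟩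

theorem sameCycle_swap_mul_iff {σ : Perm α} {j k : α} (h : ¬ σ.SameCycle j k) (x : α) :
    (swap j k * σ).SameCycle j x ↔ σ.SameCycle j x ∨ σ.SameCycle k x := by
  constructor
  · intro hx
    by_contra! hn
    exact hn.1 ((sameCycle_congr (swap_mul_pow_of_not_sameCycle hn.1 hn.2) j).mp hx.symm).symm
  · rintro (hx | hx)
    · obtain ⟨t, ht, rfl⟩ := exists_lt_minimalPeriod hx
      exact ⟨t, by rw [zpow_natCast, swap_mul_pow_apply h ht]⟩
    · obtain ⟨t, ht, rfl⟩ := exists_lt_minimalPeriod hx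
      exact ⟨(Function.minimalPeriod σ j + t : ℕ), by
        rw [zpow_natCast, swap_mul_pow_minimalPeriod_add h ht]⟩

theorem sameCycle_swap_mul_iff_or {σ : Perm α} {j k : α} (h : ¬ σ.SameCycle j k) (x y : α) :
    (swap j k * σ).SameCycle x y ↔ σ.SameCycle x y ∨
      (σ.SameCycle j x ∨ σ.SameCycle k x) ∧ (σ.SameCycle j y ∨ σ.SameCycle k y) := by
  by_cases hx : σ.SameCycle j x ∨ σ.SameCycle k x
  · have hjx := (sameCycle_swap_mul_iff h x).mpr hx
    have e : (swap j k * σ).SameCycle x y ↔ (swap j k * σ).SameCycle j y :=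
      ⟨hjx.trans, hjx.symm.trans⟩
    rw [e, sameCycle_swap_mul_iff h]
    refine ⟨fun hy => Or.inr ⟨hx, hy⟩, ?_⟩
    rintro (hxy | hy)
    · exact hx.imp (fun h' => h'.trans hxy) fun h' => h'.trans hxy
    · exact hy.2
  · obtain ⟨hj, hk⟩ := not_or.mp hx
    rw [sameCycle_congr (swap_mul_pow_of_not_sameCycle hj hk)]
    exact ⟨Or.inl, fun h' => h'.resolve_right fun h'' => hx h''.1⟩

/-- Multiplying by `swap j k` cuts a cycle that contains both `j` and `k` into two. -/
theorem not_sameCycle_swap_mul {σ : Perm α} {j k : α} (hjk : j ≠ k) (h : σ.SameCycle j k) :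
    ¬ (swap j k * σ).SameCycle j k := by
  classical
  have hex := sameCycle_iff_exists_nat.mp h
  -- the first visit of `k` on the `σ`-orbit of `j`; there the new permutation returns to `j`
  obtain ⟨s, hs, hmin⟩ : ∃ s : ℕ, (σ ^ s) j = k ∧ ∀ t < s, (σ ^ t) j ≠ k :=
    ⟨Nat.find hex, Nat.find_spec hex, fun t ht => Nat.find_min hex ht⟩
  have hj : ∀ t < s, t ≠ 0 → (σ ^ t) j ≠ j := by
    intro t ht h0 e
    refine hmin (s - t) (by omega) ?_
    rw [← hs]
    conv_rhs => rw [← Nat.sub_add_cancel ht.le, pow_add, Perm.mul_apply, e]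
  have hlt : ∀ t < s, ((swap j k * σ) ^ t) j = (σ ^ t) j := by
    intro t
    induction t with
    | zero => intro _; rfl
    | succ t ih =>
      intro ht
      have e : σ ((σ ^ t) j) = (σ ^ (t + 1)) j := by rw [pow_succ', Perm.mul_apply]
      rw [pow_succ', Perm.mul_apply, ih (by omega), Perm.mul_apply, e]
      exact swap_apply_of_ne_of_ne (hj _ ht (by omega)) (hmin _ ht)
  have hs0 : 0 < s := Nat.pos_of_ne_zero fun h0 => hjk (by rw [← hs, h0]; rfl)
  have hret : Function.IsPeriodicPt (swap j k * σ : Perm α) s j := by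
    rw [Function.IsPeriodicPt, Function.IsFixedPt, Perm.iterate_eq_pow]
    obtain ⟨l, rfl⟩ := Nat.exists_eq_succ_of_ne_zero hs0.ne'
    rw [Nat.succ_eq_add_one, pow_succ', Perm.mul_apply] at hs
    rw [Nat.succ_eq_add_one, pow_succ', Perm.mul_apply, hlt l (by omega), Perm.mul_apply, hs,
      swap_apply_right]
  intro hc
  obtain ⟨t, ht⟩ := sameCycle_iff_exists_nat.mp hc
  rw [← Perm.iterate_eq_pow, ← hret.iterate_mod_apply, Perm.iterate_eq_pow,
    hlt _ (Nat.mod_lt _ hs0)] at ht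
  exact hmin _ (Nat.mod_lt _ hs0) ht

end Permutations

/-! ### Least elements of cycles -/

theorem mem_cycleLeaders {n : ℕ} {σ : Perm (Fin n)} {i k : Fin n} :
    k ∈ cycleLeaders σ i ↔ ¬ σ.SameCycle i k ∧ ∀ m, σ.SameCycle k m → k ≤ m := by
  simp [cycleLeaders]

theorem nodup_cycleLeaders {n : ℕ} (σ : Perm (Fin n)) (i : Fin n) : (cycleLeaders σ i).Nodup :=
  (List.nodup_finRange n).filter _

theorem cycleLeaders_congr {n : ℕ} {σ τ : Perm (Fin n)}
    (h : ∀ x y, τ.SameCycle x y ↔ σ.SameCycle x y) (i : Fin n) :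
    cycleLeaders τ i = cycleLeaders σ i := by
  simp [cycleLeaders, h]

theorem exists_least_sameCycle {n : ℕ} (σ : Perm (Fin n)) (i : Fin n) :
    ∃ m, σ.SameCycle i m ∧ ∀ x, σ.SameCycle m x → m ≤ x := by
  have hne : ((Finset.univ : Finset (Fin n)).filter (σ.SameCycle i)).Nonempty :=
    ⟨i, by simpa using SameCycle.refl σ i⟩
  refine ⟨_, (Finset.mem_filter.mp (Finset.min'_mem _ hne)).2, fun x hx => ?_⟩
  exact Finset.min'_le _ _
    (by simpa using (Finset.mem_filter.mp (Finset.min'_mem _ hne)).2.trans hx)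

/-- A product over the leaders of all cycles splits off the factor of the cycle of `i`. -/
theorem prod_least_eq_mul_prod_cycleLeaders {M : Type*} [CommMonoid M] {n : ℕ}
    (σ : Perm (Fin n)) (i : Fin n) (g : Fin n → M) (hg : ∀ x y, σ.SameCycle x y → g x = g y) :
    ∏ k with ∀ m, σ.SameCycle k m → k ≤ m, g k = g i * ((cycleLeaders σ i).map g).prod := by
  obtain ⟨m, hm, hmin⟩ := exists_least_sameCycle σ i
  have hnm : m ∉ (cycleLeaders σ i).toFinset := by simp [mem_cycleLeaders, hm]
  rw [hg i m hm, ← List.prod_toFinset g (nodup_cycleLeaders σ i), ← Finset.prod_insert hnm]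
  refine Finset.prod_congr ?_ fun _ _ => rfl
  ext x
  simp only [Finset.mem_filter, Finset.mem_univ, true_and, Finset.mem_insert, List.mem_toFinset,
    mem_cycleLeaders]
  constructor
  · intro hx
    by_cases hix : σ.SameCycle i x
    · exact Or.inl (le_antisymm (hx m (hix.symm.trans hm)) (hmin x (hm.symm.trans hix)))
    · exact Or.inr ⟨hix, hx⟩
  · rintro (rfl | hx)
    · exact hmin
    · exact hx.2

/-- Splitting off the cycle of `k` from the cycles that avoid `j`: the leaders that remain are those
of `swap j k * σ`, in which the cycles of `j` and `k` are merged. -/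
theorem prod_cycleLeaders_eq_mul {M : Type*} [CommMonoid M] {n : ℕ}
    {σ : Perm (Fin n)} {j k : Fin n} (h : ¬ σ.SameCycle j k) (g : Fin n → M)
    (hg : ∀ x y, σ.SameCycle x y → g x = g y) :
    ((cycleLeaders σ j).map g).prod = g k * ((cycleLeaders (swap j k * σ) j).map g).prod := by
  obtain ⟨m, hm, hmin⟩ := exists_least_sameCycle σ k
  have hnm : m ∉ (cycleLeaders (swap j k * σ) j).toFinset := by
    simp [mem_cycleLeaders, sameCycle_swap_mul_iff h, hm]
  rw [hg k m hm, ← List.prod_toFinset g (nodup_cycleLeaders σ j),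
    ← List.prod_toFinset g (nodup_cycleLeaders _ j), ← Finset.prod_insert hnm]
  refine Finset.prod_congr ?_ fun _ _ => rfl
  ext x
  simp only [Finset.mem_insert, List.mem_toFinset, mem_cycleLeaders, sameCycle_swap_mul_iff h,
    not_or]
  have hoff : ¬ σ.SameCycle j x → ¬ σ.SameCycle k x → ∀ y,
      (swap j k * σ).SameCycle x y ↔ σ.SameCycle x y := fun h1 h2 =>
    sameCycle_congr (swap_mul_pow_of_not_sameCycle h1 h2)
  constructor
  · rintro ⟨hjx, hx⟩
    by_cases hkx : σ.SameCycle k x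
    · exact Or.inl (le_antisymm (hx m (hkx.symm.trans hm)) (hmin x (hm.symm.trans hkx)))
    · exact Or.inr ⟨⟨hjx, hkx⟩, fun y hy => hx y ((hoff hjx hkx y).mp hy)⟩
  · rintro (rfl | ⟨⟨hjx, hkx⟩, hx⟩)
    · exact ⟨fun h' => h (h'.trans hm.symm), hmin⟩
    · exact ⟨hjx, fun y hy => hx y ((hoff hjx hkx y).mpr hy)⟩

/-! ### Words of cycles -/

section Words

variable {R : Type*} [Ring R] {n : ℕ}

theorem cycleWord_congr (A : Matrix (Fin n) (Fin n) R) {σ τ : Perm (Fin n)} {k : Fin n}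
    (h : ∀ t : ℕ, (τ ^ t) k = (σ ^ t) k) : cycleWord A τ k = cycleWord A σ k := by
  simp only [cycleWord, minimalPeriod_congr h, h]

/-- If the entries between the points of a cycle are Hermitian, the word of the reversed cycle is the
conjugate of the word of the cycle. -/
theorem cycleWord_inv [StarRing R] {A : Matrix (Fin n) (Fin n) R} {σ : Perm (Fin n)} {k : Fin n}
    (hA : ∀ x y, σ.SameCycle k x → σ.SameCycle k y → star (A x y) = A y x) :
    cycleWord A σ⁻¹ k = star (cycleWord A σ k) := by
  have hper : Function.minimalPeriod (σ⁻¹ : Perm (Fin n)) k = Function.minimalPeriod σ k := by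
    apply Function.minimalPeriod_eq_minimalPeriod_iff.mpr
    intro t
    rw [Function.IsPeriodicPt, Function.IsPeriodicPt, Function.IsFixedPt, Function.IsFixedPt,
      Perm.iterate_eq_pow, Perm.iterate_eq_pow, inv_pow, Perm.inv_eq_iff_eq, eq_comm]
  have hk := pow_minimalPeriod_apply σ k
  simp only [cycleWord, hper]
  generalize Function.minimalPeriod σ k = l at hk
  -- both words run through the same entries, read from opposite ends
  have hstep : ∀ t ≤ l, ((σ⁻¹) ^ t) k = (σ ^ (l - t)) k := by
    intro t ht
    rw [inv_pow, Perm.inv_eq_iff_eq, ← Perm.mul_apply, ← pow_add, Nat.add_sub_cancel' ht, hk]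
  have hs : ∀ t : ℕ, σ.SameCycle k ((σ ^ t) k) := fun t => ⟨t, by simp⟩
  have hrev : ∀ (l : ℕ) (f : ℕ → R), star ((List.range l).map f).prod =
      ((List.range l).map fun t => star (f (l - 1 - t))).prod := by
    intro l f
    induction l with
    | zero => simp
    | succ l ih =>
      rw [List.range_succ, List.map_append, List.prod_append, star_mul, ih, ← List.range_succ,
        List.range_succ_eq_map]
      simp only [List.map_cons, List.map_nil, List.prod_cons, List.prod_nil, mul_one,
        List.map_map]
      congr 2
      apply List.map_congr_left
      intro t _
      simp only [Function.comp]
      congr 2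
      omega
  rw [hrev]
  congr 1
  apply List.map_congr_left
  intro t ht
  have ht' := List.mem_range.mp ht
  rw [hstep t (by omega), hstep (t + 1) (by omega), hA _ _ (hs _) (hs _)]
  congr 3 <;> omega

/-- When the columns `j` and `k` of `B` agree, merging the cycles of `j` and `k` concatenates their
words: the step that now leads to the other cycle still contributes the same matrix entry. -/
theorem cycleWord_swap_mul {B : Matrix (Fin n) (Fin n) R} {σ : Perm (Fin n)} {j k : Fin n}
    (h : ¬ σ.SameCycle j k) (hB : ∀ p, B p j = B p k) :
    cycleWord B (swap j k * σ) j = cycleWord B σ j * cycleWord B σ k := by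
  have hstep : ∀ p x, B p (swap j k x) = B p x := by
    intro p x
    by_cases hx : x = j
    · rw [hx, swap_apply_left, hB]
    · by_cases hx' : x = k
      · rw [hx', swap_apply_right, hB]
      · rw [swap_apply_of_ne_of_ne hx hx']
  have hentry : ∀ t, B (((swap j k * σ) ^ t) j) (((swap j k * σ) ^ (t + 1)) j) =
      B (((swap j k * σ) ^ t) j) (σ (((swap j k * σ) ^ t) j)) := by
    intro t
    rw [pow_succ' _ t, Perm.mul_apply, Perm.mul_apply, hstep]
  simp only [cycleWord, hentry]
  rw [minimalPeriod_swap_mul h, List.range_add, List.map_append, List.prod_append, List.map_map]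
  congr 2
  · apply List.map_congr_left
    intro t ht
    rw [swap_mul_pow_apply h (List.mem_range.mp ht), pow_succ' σ t, Perm.mul_apply]
  · apply List.map_congr_left
    intro t ht
    simp only [Function.comp]
    rw [swap_mul_pow_minimalPeriod_add h (List.mem_range.mp ht), pow_succ' σ t, Perm.mul_apply]

theorem cycleWord_updateCol_of_not_sameCycle (B : Matrix (Fin n) (Fin n) R) {σ : Perm (Fin n)}
    {j k : Fin n} (h : ¬ σ.SameCycle j k) (f : Fin n → R) :
    cycleWord (B.updateCol j f) σ k = cycleWord B σ k := by
  simp only [cycleWord]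
  congr 1
  apply List.map_congr_left
  intro t _
  apply Matrix.updateCol_ne
  rintro e
  exact h (SameCycle.symm ⟨(t + 1 : ℕ), by rwa [zpow_natCast]⟩)

/-- The only factor of the word of `j` from the column `j` is the last one. -/
theorem exists_cycleWord_updateCol (B : Matrix (Fin n) (Fin n) R) (σ : Perm (Fin n)) (j : Fin n) :
    ∃ c : R, ∀ f : Fin n → R, cycleWord (B.updateCol j f) σ j = c * f (σ⁻¹ j) := by
  obtain ⟨l, hl⟩ := Nat.exists_eq_succ_of_ne_zero (minimalPeriod_pos σ j).ne'
  refine ⟨((List.range l).map fun m => B ((σ ^ m) j) ((σ ^ (m + 1)) j)).prod, fun f => ?_⟩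
  have hp := pow_minimalPeriod_apply σ j
  rw [hl, Nat.succ_eq_add_one] at hp
  simp only [cycleWord, hl]
  rw [Nat.succ_eq_add_one, List.range_succ, List.map_append, List.prod_append]
  congr 1
  · congr 1
    apply List.map_congr_left
    intro t ht
    apply Matrix.updateCol_ne
    exact pow_apply_ne_of_lt_minimalPeriod (by omega) (by have := List.mem_range.mp ht; omega)
  · rw [List.map_singleton, List.prod_singleton, hp, Matrix.updateCol_self]
    congr 1
    rw [eq_comm, Perm.inv_eq_iff_eq, ← Perm.mul_apply, ← pow_succ', hp]

theorem exists_cdet_updateCol (B : Matrix (Fin n) (Fin n) R) (j : Fin n) :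
    ∃ c : Perm (Fin n) → R, ∀ f : Fin n → R,
      cdet j (B.updateCol j f) = ∑ σ, c σ * f (σ⁻¹ j) := by
  choose c hc using fun σ => exists_cycleWord_updateCol B σ j
  refine ⟨fun σ => sign σ • (((cycleLeaders σ j).reverse.map (cycleWord B σ)).prod * c σ),
    fun f => ?_⟩
  simp only [cdet]
  refine Finset.sum_congr rfl fun σ _ => ?_
  rw [hc, smul_mul_assoc, mul_assoc]
  congr 3
  apply List.map_congr_left
  intro k hk
  exact cycleWord_updateCol_of_not_sameCycle B
    (mem_cycleLeaders.mp (List.mem_reverse.mp hk)).1 f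

/-- `cdet j` is a right linear function of the `j`-th column. -/
theorem cdet_updateCol_mulVec (B C : Matrix (Fin n) (Fin n) R) (j : Fin n) (x : Fin n → R) :
    cdet j (B.updateCol j (C *ᵥ x)) = ∑ k, cdet j (B.updateCol j fun p => C p k) * x k := by
  obtain ⟨c, hc⟩ := exists_cdet_updateCol B j
  simp only [hc, Matrix.mulVec, dotProduct, Finset.mul_sum, Finset.sum_mul, mul_assoc]
  exact Finset.sum_comm

end Words

/-! ### Averaging over the orientations of cycles -/

section Averaging

variable {n : ℕ}

theorem map_prod_add_map_prod {ι R : Type*} [Ring R] {l : List ι} (hl : l.Nodup) {m : ι}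
    (hm : m ∈ l) {f g h : ι → R} (hfg : ∀ x, x ≠ m → g x = f x) (hfh : ∀ x, x ≠ m → h x = f x)
    (hsum : f m + g m = h m + h m) :
    (l.map f).prod + (l.map g).prod = (l.map h).prod + (l.map h).prod := by
  obtain ⟨s, t, rfl⟩ := List.append_of_mem hm
  have hms : m ∉ s ∧ m ∉ t := by
    rw [List.nodup_middle, List.nodup_cons, List.mem_append, not_or] at hl
    exact hl.1
  have hcongr : ∀ u : List ι, m ∉ u → ∀ g : ι → R, (∀ x, x ≠ m → g x = f x) →
      (u.map g).prod = (u.map f).prod := fun u hu g hg => by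
    rw [List.map_congr_left fun x hx => hg x (ne_of_mem_of_not_mem hx hu)]
  simp only [List.map_append, List.map_cons, List.prod_append, List.prod_cons]
  rw [hcongr s hms.1 g hfg, hcongr t hms.2 g hfg, hcongr s hms.1 h hfh, hcongr t hms.2 h hfh,
    ← mul_add, ← mul_add, ← add_mul, ← add_mul, hsum]

/-- A summand may be replaced by its average over the orbits of an involution. -/
theorem sum_eq_of_involutive_average {ι E : Type*} [AddCommGroup E] [Module ℝ E] (s : Finset ι)
    {φ : ι → ι} (hφs : ∀ x ∈ s, φ x ∈ s) (hφ : ∀ x ∈ s, φ (φ x) = x) {f g : ι → E}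
    (h : ∀ x ∈ s, f x + f (φ x) = g x + g x) : ∑ x ∈ s, f x = ∑ x ∈ s, g x := by
  have e : ∑ x ∈ s, f (φ x) = ∑ x ∈ s, f x :=
    Finset.sum_nbij' φ φ hφs hφs hφ hφ fun _ _ => rfl
  have h2 : (2 : ℝ) • ∑ x ∈ s, f x = (2 : ℝ) • ∑ x ∈ s, g x := by
    rw [two_smul, two_smul]
    nth_rewrite 2 [← e]
    rw [← Finset.sum_add_distrib, ← Finset.sum_add_distrib]
    exact Finset.sum_congr rfl h
  exact smul_right_injective E (two_ne_zero (α := ℝ)) h2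

variable {A B : Matrix (Fin n) (Fin n) ℍ[ℝ]}

/-- Reversing a cycle conjugates its word, provided the entries met by the cycle are Hermitian. -/
theorem cycleWord_flipCycle_self {σ : Perm (Fin n)} {m : Fin n}
    (hB : ∀ x y, σ.SameCycle m x → σ.SameCycle m y → star (B x y) = B y x) :
    cycleWord B (flipCycle m σ) m = star (cycleWord B σ m) := by
  rw [cycleWord_congr B (flipCycle_pow_of_sameCycle (SameCycle.refl σ m)), cycleWord_inv hB]

theorem cycleWord_flipCycle_of_not_sameCycle {σ : Perm (Fin n)} {m k : Fin n}
    (h : ¬ σ.SameCycle m k) : cycleWord B (flipCycle m σ) k = cycleWord B σ k :=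
  cycleWord_congr B (flipCycle_pow_of_not_sameCycle h)

/-- The words of a cycle from two starting points are cyclic rotations of each other, so that they
have the same real part. -/
theorem re_cycleWord_congr (B : Matrix (Fin n) (Fin n) ℍ[ℝ]) {σ : Perm (Fin n)} {x y : Fin n}
    (h : σ.SameCycle x y) : (cycleWord B σ x).re = (cycleWord B σ y).re := by
  have re_mul_comm : ∀ a b : ℍ[ℝ], (a * b).re = (b * a).re := fun a b => by
    simp only [Quaternion.re_mul]; ring
  have hstep : ∀ x, (cycleWord B σ (σ x)).re = (cycleWord B σ x).re := by
    intro x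
    have hper : Function.minimalPeriod σ (σ x) = Function.minimalPeriod σ x :=
      Function.minimalPeriod_apply
        (Function.Injective.mem_periodicPts σ.injective x)
    have hp := pow_minimalPeriod_apply σ x
    obtain ⟨l, hl⟩ := Nat.exists_eq_succ_of_ne_zero (minimalPeriod_pos σ x).ne'
    have hshift : ∀ t : ℕ, (σ ^ t) (σ x) = (σ ^ (t + 1)) x := fun t => by
      rw [pow_succ, Perm.mul_apply]
    simp only [cycleWord, hper, hl, hshift]
    rw [hl, Nat.succ_eq_add_one] at hp
    rw [Nat.succ_eq_add_one, List.range_succ, List.map_append, List.prod_append, re_mul_comm,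
      ← List.range_succ, List.range_succ_eq_map]
    simp only [List.map_cons, List.map_nil, List.prod_cons, List.prod_nil, mul_one, List.map_map]
    rw [pow_succ' σ (l + 1), Perm.mul_apply, hp]
    rfl
  obtain ⟨t, rfl⟩ := sameCycle_iff_exists_nat.mp h
  induction t with
  | zero => rfl
  | succ t ih => rw [pow_succ', Perm.mul_apply, hstep]; exact ih ⟨t, by simp⟩

/-- In the column determinant of a matrix that is Hermitian off the row and column `i`, the words of
the cycles avoiding `i` may be replaced by their real parts. -/
theorem cdet_eq_sum_re (i : Fin n) (hB : ∀ x y, x ≠ i → y ≠ i → star (B x y) = B y x) :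
    cdet i B = ∑ σ : Perm (Fin n), sign σ •
      (((cycleLeaders σ i).map fun k => (cycleWord B σ k).re).prod • cycleWord B σ i) := by
  -- the words at the points of `s` have been replaced by their real parts
  let w : Finset (Fin n) → Perm (Fin n) → Fin n → ℍ[ℝ] := fun s σ k =>
    if k ∈ s then ((cycleWord B σ k).re : ℍ[ℝ]) else cycleWord B σ k
  have key : ∀ s : Finset (Fin n), cdet i B = ∑ σ : Perm (Fin n), sign σ •
      (((cycleLeaders σ i).reverse.map (w s σ)).prod * cycleWord B σ i) := by
    intro s
    induction s using Finset.induction_on with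
    | empty => simp [cdet, w]
    | insert m s hms ih =>
      rw [ih]
      refine sum_eq_of_involutive_average Finset.univ
        (φ := fun σ => if m ∈ cycleLeaders σ i then flipCycle m σ else σ)
        (fun _ _ => Finset.mem_univ _) (fun σ _ => ?_) (fun σ _ => ?_)
      · by_cases hm : m ∈ cycleLeaders σ i
        · simp only [hm, if_true, cycleLeaders_congr (fun x y => sameCycle_flipCycle),
            flipCycle_flipCycle]
        · simp only [hm, if_false]
      · by_cases hm : m ∈ cycleLeaders σ i
        · obtain ⟨him, hmin⟩ := mem_cycleLeaders.mp hm
          have hne : ∀ x, σ.SameCycle m x → x ≠ i := by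
            rintro x hx rfl; exact him hx.symm
          have hself := cycleWord_flipCycle_self (B := B) (σ := σ) (m := m)
            fun x y hx hy => hB x y (hne x hx) (hne y hy)
          simp only [hm, if_true]
          rw [sign_flipCycle, cycleLeaders_congr (fun x y => sameCycle_flipCycle),
            cycleWord_flipCycle_of_not_sameCycle (fun h => him h.symm), ← smul_add, ← smul_add,
            ← add_mul, ← add_mul]
          congr 2
          -- two leaders lie in different cycles, so only the word at `m` changes
          have hoff : ∀ k ∈ (cycleLeaders σ i).reverse, k ≠ m →
              cycleWord B (flipCycle m σ) k = cycleWord B σ k := by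
            intro k hk hkm
            apply cycleWord_flipCycle_of_not_sameCycle
            intro hmk
            have hk' := (mem_cycleLeaders.mp (List.mem_reverse.mp hk)).2
            exact hkm (le_antisymm (hk' m hmk.symm) (hmin k hmk))
          have hcongr : (cycleLeaders σ i).reverse.map (w s (flipCycle m σ)) =
              (cycleLeaders σ i).reverse.map
                fun k => if k = m then star (cycleWord B σ m) else w s σ k := by
            apply List.map_congr_left
            intro k hk
            by_cases hkm : k = m
            · subst hkm
              simp [w, hms, hself]
            · simp [w, hkm, hoff k hk hkm]
          rw [hcongr]
          refine map_prod_add_map_prod (List.nodup_reverse.mpr (nodup_cycleLeaders σ i))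
            (List.mem_reverse.mpr hm) ?_ ?_ ?_
          · intro x hx; simp [hx]
          · intro x hx; simp [w, hx]
          · simp [w, hms, Quaternion.self_add_star, two_mul]
        · simp only [hm, if_false]
          have : (cycleLeaders σ i).reverse.map (w (insert m s) σ) =
              (cycleLeaders σ i).reverse.map (w s σ) := by
            apply List.map_congr_left
            intro k hk
            have hkm : k ≠ m := by
              rintro rfl; exact hm (List.mem_reverse.mp hk)
            simp [w, hkm]
          rw [this]
  rw [key Finset.univ]
  refine Finset.sum_congr rfl fun σ _ => ?_
  have hreal : ∀ l : List (Fin n), (l.map (w Finset.univ σ)).prod =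
      (((l.map fun k => (cycleWord B σ k).re).prod : ℝ) : ℍ[ℝ]) := by
    intro l
    induction l with
    | nil => simp
    | cons a l ih =>
      rw [List.map_cons, List.map_cons, List.prod_cons, List.prod_cons, ih, Quaternion.coe_mul]
      simp [w]
  rw [hreal, List.map_reverse, List.prod_reverse, Quaternion.coe_mul_eq_smul]

/-! ### Row and column determinants of Hermitian matrices -/

/-- The real number to which all row and column determinants of a Hermitian matrix are equal: in each
monomial every cycle contributes the real part of its word. -/
noncomputable def realDet (A : Matrix (Fin n) (Fin n) ℍ[ℝ]) : ℝ :=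
  ∑ σ : Perm (Fin n), sign σ • ∏ k with ∀ m, σ.SameCycle k m → k ≤ m, (cycleWord A σ k).re

theorem cdet_eq_realDet (hA : A.IsHermitian) (i : Fin n) : cdet i A = (realDet A : ℍ[ℝ]) := by
  have hA' : ∀ x y, star (A x y) = A y x := fun x y => hA.apply y x
  rw [cdet_eq_sum_re i fun x y _ _ => hA' x y]
  -- averaging over the orientation of the cycle of `i` as well
  have h : ∑ σ : Perm (Fin n), sign σ •
        (((cycleLeaders σ i).map fun k => (cycleWord A σ k).re).prod • cycleWord A σ i) =
      ∑ σ : Perm (Fin n), sign σ •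
        (((cycleLeaders σ i).map fun k => (cycleWord A σ k).re).prod •
          ((cycleWord A σ i).re : ℍ[ℝ])) := by
    refine sum_eq_of_involutive_average Finset.univ (φ := flipCycle i)
      (fun _ _ => Finset.mem_univ _) (fun σ _ => flipCycle_flipCycle i σ) (fun σ _ => ?_)
    have : (cycleLeaders σ i).map (fun k => (cycleWord A (flipCycle i σ) k).re) =
        (cycleLeaders σ i).map fun k => (cycleWord A σ k).re := by
      apply List.map_congr_left
      intro k hk
      rw [cycleWord_flipCycle_of_not_sameCycle (mem_cycleLeaders.mp hk).1]
    rw [sign_flipCycle, cycleLeaders_congr (fun x y => sameCycle_flipCycle), this,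
      cycleWord_flipCycle_self fun x y _ _ => hA' x y, ← smul_add, ← smul_add, ← smul_add,
      ← smul_add, Quaternion.self_add_star, two_mul]
  have hcoe : ∀ f : Perm (Fin n) → ℝ, ((∑ σ, f σ : ℝ) : ℍ[ℝ]) = ∑ σ, (f σ : ℍ[ℝ]) := fun f =>
    map_sum (algebraMap ℝ ℍ[ℝ]) f Finset.univ
  rw [h, realDet, hcoe]
  refine Finset.sum_congr rfl fun σ _ => ?_
  rw [prod_least_eq_mul_prod_cycleLeaders σ i (fun k => (cycleWord A σ k).re)
    (fun x y hxy => re_cycleWord_congr A hxy), mul_comm (cycleWord A σ i).re,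
    ← Quaternion.coe_mul_eq_smul, ← Quaternion.coe_mul]
  rcases Int.units_eq_one_or (sign σ) with hs | hs <;> simp [hs]

/-- The reindexing `σ ↦ σ⁻¹` conjugates each word, and `star` reverses the order of the words. -/
theorem star_rdet (hA : A.IsHermitian) (i : Fin n) : star (rdet i A) = cdet i A := by
  have hA' : ∀ x y, star (A x y) = A y x := fun x y => hA.apply y x
  have hprod : ∀ (σ : Perm (Fin n)) (l : List (Fin n)), star (l.map (cycleWord A σ)).prod =
      (l.reverse.map (cycleWord A σ⁻¹)).prod := by
    intro σ l
    induction l with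
    | nil => simp
    | cons a l ih => simp [ih, cycleWord_inv fun x y _ _ => hA' x y]
  rw [rdet, cdet, star_sum, ← Equiv.sum_comp (Equiv.inv (Perm (Fin n)))]
  refine Finset.sum_congr rfl fun σ _ => ?_
  rw [Equiv.inv_apply, sign_inv, cycleLeaders_congr (fun x y => sameCycle_inv)]
  have hs : ∀ (u : ℤˣ) (q : ℍ[ℝ]), star (u • q) = u • star q := by
    intro u q
    rcases Int.units_eq_one_or u with h | h <;> simp [h]
  rw [hs, star_mul, hprod, inv_inv, cycleWord_inv fun x y _ _ => hA' x y, star_star]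

theorem rdet_eq_realDet (hA : A.IsHermitian) (i : Fin n) : rdet i A = (realDet A : ℍ[ℝ]) := by
  rw [← star_star (rdet i A), star_rdet hA, cdet_eq_realDet hA, Quaternion.star_coe]

theorem hermDet_eq_realDet (hA : A.IsHermitian) : hermDet A = (realDet A : ℍ[ℝ]) := by
  cases n with
  | zero => simp [hermDet, realDet]
  | succ n => exact rdet_eq_realDet hA 0

/-! ### Cramer's rule -/

/-- The column determinant along a column vanishes if this column is repeated. The permutations with
`j` and `k` in one cycle cancel against those with `j` and `k` in two
cycles, under `σ ↦ swap j k * σ`. -/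
theorem cdet_eq_zero_of_col_eq {j k : Fin n} (hjk : j ≠ k)
    (hB : ∀ x y, x ≠ j → y ≠ j → star (B x y) = B y x) (hcol : ∀ p, B p j = B p k) :
    cdet j B = 0 := by
  rw [cdet_eq_sum_re j hB,
    ← Finset.sum_filter_add_sum_filter_not Finset.univ fun σ : Perm (Fin n) => ¬ σ.SameCycle j k]
  let N : Perm (Fin n) → ℝ := fun σ =>
    ((cycleLeaders (swap j k * σ) j).map fun x => (cycleWord B σ x).re).prod
  have hmem : ∀ σ : Perm (Fin n), ∀ x ∈ cycleLeaders (swap j k * σ) j, ¬ σ.SameCycle j k →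
      ¬ σ.SameCycle j x ∧ ¬ σ.SameCycle k x := fun σ x hx h => by
    simpa [sameCycle_swap_mul_iff h] using (mem_cycleLeaders.mp hx).1
  -- the permutations with `j` and `k` in different cycles
  have hsplit : ∑ σ : Perm (Fin n) with ¬ σ.SameCycle j k, sign σ •
        (((cycleLeaders σ j).map fun x => (cycleWord B σ x).re).prod • cycleWord B σ j) =
      ∑ σ : Perm (Fin n) with ¬ σ.SameCycle j k,
        sign σ • (N σ • (cycleWord B σ j * ((cycleWord B σ k).re : ℍ[ℝ]))) := by
    refine Finset.sum_congr rfl fun σ hσ => ?_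
    rw [prod_cycleLeaders_eq_mul (Finset.mem_filter.mp hσ).2 (fun x => (cycleWord B σ x).re)
      (fun x y hxy => re_cycleWord_congr B hxy), Quaternion.mul_coe_eq_smul, smul_smul, mul_comm]
  -- the permutations with `j` and `k` in the same cycle, reindexed by `σ ↦ swap j k * σ`
  have hmerge : ∑ σ : Perm (Fin n) with ¬ ¬ σ.SameCycle j k, sign σ •
        (((cycleLeaders σ j).map fun x => (cycleWord B σ x).re).prod • cycleWord B σ j) =
      ∑ σ : Perm (Fin n) with ¬ σ.SameCycle j k,
        -(sign σ • (N σ • (cycleWord B σ j * cycleWord B σ k))) := by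
    refine Finset.sum_nbij' (fun σ => swap j k * σ) (fun σ => swap j k * σ) (fun σ hσ => ?_)
      (fun σ hσ => ?_) (fun σ _ => swap_mul_self_mul j k σ)
      (fun σ _ => swap_mul_self_mul j k σ) (fun σ hσ => ?_)
    · simpa using not_sameCycle_swap_mul hjk (not_not.mp (Finset.mem_filter.mp hσ).2)
    · simpa using sameCycle_swap_mul (Finset.mem_filter.mp hσ).2
    · have h := not_sameCycle_swap_mul hjk (not_not.mp (Finset.mem_filter.mp hσ).2)
      obtain ⟨τ, rfl⟩ : ∃ τ, σ = swap j k * τ := ⟨swap j k * σ, (swap_mul_self_mul j k σ).symm⟩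
      simp only [swap_mul_self_mul] at h ⊢
      rw [cycleWord_swap_mul h hcol, Perm.sign_mul, sign_swap hjk, neg_one_mul, Units.neg_smul]
      congr 3
      simp only [N]
      congr 1
      apply List.map_congr_left
      intro x hx
      obtain ⟨h1, h2⟩ := hmem τ x hx h
      rw [cycleWord_congr B (swap_mul_pow_of_not_sameCycle h1 h2)]
  -- averaging over the orientation of the cycle of `k`
  have hflip : ∑ σ : Perm (Fin n) with ¬ σ.SameCycle j k,
        sign σ • (N σ • (cycleWord B σ j * cycleWord B σ k)) =
      ∑ σ : Perm (Fin n) with ¬ σ.SameCycle j k,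
        sign σ • (N σ • (cycleWord B σ j * ((cycleWord B σ k).re : ℍ[ℝ]))) := by
    refine sum_eq_of_involutive_average _ (φ := flipCycle k) (fun σ hσ => ?_)
      (fun σ _ => flipCycle_flipCycle k σ) (fun σ hσ => ?_)
    · simpa [sameCycle_flipCycle] using hσ
    · have h : ¬ σ.SameCycle j k := (Finset.mem_filter.mp hσ).2
      have hf : ¬ (flipCycle k σ).SameCycle j k := fun h' => h (sameCycle_flipCycle.mp h')
      have hne : ∀ x, σ.SameCycle k x → x ≠ j := by
        rintro x hx rfl; exact h hx.symm
      have hN : N (flipCycle k σ) = N σ := by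
        have hl : cycleLeaders (swap j k * flipCycle k σ) j = cycleLeaders (swap j k * σ) j := by
          refine cycleLeaders_congr (fun x y => ?_) j
          simp only [sameCycle_swap_mul_iff_or h, sameCycle_swap_mul_iff_or hf,
            sameCycle_flipCycle]
        simp only [N, hl]
        congr 1
        apply List.map_congr_left
        intro x hx
        rw [cycleWord_flipCycle_of_not_sameCycle (hmem σ x hx h).2]
      rw [hN, sign_flipCycle, cycleWord_flipCycle_of_not_sameCycle (fun h' => h h'.symm),
        cycleWord_flipCycle_self fun x y hx hy => hB x y (hne x hx) (hne y hy), ← smul_add,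
        ← smul_add, ← smul_add, ← smul_add, ← mul_add, ← mul_add, Quaternion.self_add_star,
        two_mul]
  rw [hsplit, hmerge, Finset.sum_neg_distrib, hflip, add_neg_cancel]

end Averaging

/-- Cramer's rule for the Hermitian matrix `H`, with denominators cleared. -/
theorem cdet_updateCol_mulVec_self {n : ℕ} {H : Matrix (Fin n) (Fin n) ℍ[ℝ]}
    (hH : H.IsHermitian) (x : Fin n → ℍ[ℝ]) (j : Fin n) :
    cdet j (H.updateCol j (H *ᵥ x)) = (realDet H : ℍ[ℝ]) * x j := by
  rw [cdet_updateCol_mulVec, Finset.sum_eq_single j]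
  · have : H.updateCol j (fun p => H p j) = H := Matrix.updateCol_eq_self H j
    rw [this, cdet_eq_realDet hH]
  · intro k _ hkj
    rw [cdet_eq_zero_of_col_eq hkj.symm, zero_mul]
    · intro x y hx hy
      rw [Matrix.updateCol_ne hx, Matrix.updateCol_ne hy]
      exact hH.apply y x
    · intro p
      rw [Matrix.updateCol_self, Matrix.updateCol_ne hkj]
  · simp

/-- Here left multiplication by `A` on columns is viewed as an `ℝ`-linear map in finite dimension. -/
theorem mulVec_surjective_of_injective {n : ℕ} {A : Matrix (Fin n) (Fin n) ℍ[ℝ]}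
    (h : ∀ x, A *ᵥ x = 0 → x = 0) : Function.Surjective (A *ᵥ ·) := by
  let f : (Fin n → ℍ[ℝ]) →ₗ[ℝ] (Fin n → ℍ[ℝ]) :=
    { toFun := fun x => A *ᵥ x
      map_add' := fun x y => Matrix.mulVec_add A x y
      map_smul' := fun r x => Matrix.mulVec_smul A r x }
  have hf : Function.Injective f := (injective_iff_map_eq_zero f).mpr h
  exact LinearMap.injective_iff_surjective.mp hf

end QuaternionCramer

theorem theorem9p1 (n : ℕ) (A : Matrix (Fin n) (Fin n) ℍ[ℝ]) (y : Fin n → ℍ[ℝ]) :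
    -- the double determinant is well defined and real
    ((∀ i, QuaternionCramer.rdet i (Aᴴ * A) = QuaternionCramer.ddet A ∧
        QuaternionCramer.cdet i (Aᴴ * A) = QuaternionCramer.ddet A) ∧
      ∃ r : ℝ, QuaternionCramer.ddet A = (r : ℍ[ℝ])) ∧
    -- the system has exactly one solution, given by the formula
    (QuaternionCramer.ddet A ≠ 0 →
      ∀ x : Fin n → ℍ[ℝ], A *ᵥ x = y ↔
        ∀ j, x j = QuaternionCramer.cdet j ((Aᴴ * A).updateCol j (Aᴴ *ᵥ y)) /
          QuaternionCramer.ddet A) := by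
  have hH : (Aᴴ * A).IsHermitian := Matrix.isHermitian_conjTranspose_mul_self A
  have hd : QuaternionCramer.ddet A = (QuaternionCramer.realDet (Aᴴ * A) : ℍ[ℝ]) :=
    QuaternionCramer.hermDet_eq_realDet hH
  refine ⟨⟨fun i => ⟨?_, ?_⟩, _, hd⟩, fun hne => ?_⟩
  · rw [hd, QuaternionCramer.rdet_eq_realDet hH]
  · rw [hd, QuaternionCramer.cdet_eq_realDet hH]
  rw [hd] at hne ⊢
  have hformula : ∀ x : Fin n → ℍ[ℝ], A *ᵥ x = y → ∀ j,
      x j = QuaternionCramer.cdet j ((Aᴴ * A).updateCol j (Aᴴ *ᵥ y)) /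
        (QuaternionCramer.realDet (Aᴴ * A) : ℍ[ℝ]) := by
    rintro x rfl j
    rw [Matrix.mulVec_mulVec, QuaternionCramer.cdet_updateCol_mulVec_self hH,
      Quaternion.coe_mul_eq_smul, ← Quaternion.mul_coe_eq_smul, mul_div_cancel_right₀ _ hne]
  have hinj : ∀ x, A *ᵥ x = 0 → x = 0 := by
    intro x hx
    funext j
    have h := QuaternionCramer.cdet_updateCol_mulVec_self hH x j
    have h0 := QuaternionCramer.cdet_updateCol_mulVec_self hH 0 j
    rw [← Matrix.mulVec_mulVec, hx] at h
    rw [Matrix.mulVec_zero] at h0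
    rw [Matrix.mulVec_zero, h0, Pi.zero_apply] at h
    exact (mul_left_cancel₀ hne h).symm
  refine fun x => ⟨hformula x, fun hx => ?_⟩
  obtain ⟨x₀, hx₀⟩ := QuaternionCramer.mulVec_surjective_of_injective hinj y
  have : x = x₀ := funext fun j => (hx j).trans (hformula x₀ hx₀ j).symm
  rw [this]
  exact hx₀
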